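/- Let $(R,\mathfrak m)$ be a noetherian local integral domain that is not a field, let $E$ be the injective hull of the residue field $R/\mathfrak m$ as an $R$-module, and write $M^\circ=\operatorname{Hom}_R(M,E)$ for the Matlis dual of an $R$-module $M$. Call $M$ *reflexive* if the canonical map $M\to M^{\circ\circ}$, $x\mapsto(f\mapsto f(x))$, is an isomorphism; *bounded* if $rM=0$ for some $0\ne r\in R$; *divisible* if $rM=M$ for all $0\ne r\in R$; and *strongly torsion* if $\bigcap_{\mathfrak p\in\operatorname{Ass}(M)}\mathfrak p\neq 0$, where the intersection of the empty family is $R$ (so that the zero module is strongly torsion). Let $D(M)$ be the divisible part of $M$, that is, the largest divisible submodule of $M$ (the sum of all its divisible submodules). Then for every $R$-module $M$ the following are equivalent: 1. $M^{\circ\circ}$ is strongly torsion. 2. $D(M)$ is artinian and reflexive, and $M/D(M)$ is bounded. -/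

import Mathlib

universe u v w

namespace Matlis

/-- `i : X → E` exhibits `E` as an injective hull of `X`: `i` is an injective linear map into an
injective module, and its image is an essential submodule of `E`. -/
structure IsInjectiveHull (R : Type u) [CommRing R] {X : Type v} {E : Type w}
    [AddCommGroup X] [Module R X] [AddCommGroup E] [Module R E] (i : X →ₗ[R] E) : Prop where
  injective_map : Function.Injective i
  injective_module : Module.Injective R E
  essential : ∀ N : Submodule R E, N ≠ ⊥ → LinearMap.range i ⊓ N ≠ ⊥

/-- The dual `Hom_R(M, E)`; it is the Matlis dual when `E` is the injective hull of the
residue field of the local ring `R`. -/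
abbrev Dual (R : Type u) [CommRing R] (E : Type w) [AddCommGroup E] [Module R E]
    (M : Type v) [AddCommGroup M] [Module R M] : Type (max v w) :=
  M →ₗ[R] E

/-- The canonical map `M → Hom_R(Hom_R(M, E), E)`, `x ↦ (f ↦ f x)`. -/
def eval (R : Type u) [CommRing R] (E : Type w) [AddCommGroup E] [Module R E]
    (M : Type v) [AddCommGroup M] [Module R M] : M →ₗ[R] Dual R E (Dual R E M) :=
  LinearMap.flip LinearMap.id

@[simp]
theorem eval_apply (R : Type u) [CommRing R] (E : Type w) [AddCommGroup E] [Module R E]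
    (M : Type v) [AddCommGroup M] [Module R M] (x : M) (f : Dual R E M) :
    eval R E M x f = f x := rfl

/-- `M` is reflexive with respect to `E`: the canonical map into the bidual is bijective. -/
def IsReflexive (R : Type u) [CommRing R] (E : Type w) [AddCommGroup E] [Module R E]
    (M : Type v) [AddCommGroup M] [Module R M] : Prop :=
  Function.Bijective (eval R E M)

/-- `M` is strongly torsion: the intersection of its associated primes is a nonzero ideal
(the intersection of the empty family is the unit ideal). -/
def IsStronglyTorsion (R : Type u) [CommRing R] (M : Type v) [AddCommGroup M] [Module R M] :
    Prop :=
  sInf (associatedPrimes R M) ≠ ⊥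

/-- `M` is divisible (over a domain): `r M = M` for every nonzero `r`. -/
def IsDivisible (R : Type u) [CommRing R] (M : Type v) [AddCommGroup M] [Module R M] : Prop :=
  ∀ r : R, r ≠ 0 → ∀ x : M, ∃ y : M, r • y = x

/-- `M` is bounded: `r M = 0` for some nonzero `r`. -/
def IsBounded (R : Type u) [CommRing R] (M : Type v) [AddCommGroup M] [Module R M] : Prop :=
  ∃ r : R, r ≠ 0 ∧ ∀ x : M, r • x = 0

/-- The divisible part `D(M)`: the sum of all divisible submodules of `M`. -/
def divisiblePart (R : Type u) [CommRing R] (M : Type v) [AddCommGroup M] [Module R M] :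
    Submodule R M :=
  sSup {N : Submodule R M | IsDivisible R N}

/-- `D(M)` is itself divisible, hence the largest divisible submodule of `M`. -/
theorem isGreatest_divisiblePart (R : Type u) [CommRing R] (M : Type v) [AddCommGroup M]
    [Module R M] : IsGreatest {N : Submodule R M | IsDivisible R N} (divisiblePart R M) := by
  refine ⟨?_, fun N hN => le_sSup hN⟩
  intro r hr x
  have key : divisiblePart R M ≤ (divisiblePart R M).map (LinearMap.lsmul R M r) := by
    refine sSup_le fun N hN z hz => ?_
    obtain ⟨y, hy⟩ := hN r hr ⟨z, hz⟩
    exact ⟨y, le_sSup (a := N) hN y.2, congrArg Subtype.val hy⟩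
  obtain ⟨y, hy, hyx⟩ := key x.2
  exact ⟨⟨y, hy⟩, Subtype.ext hyx⟩

end Matlis

/-!
Write `X = Hom_R(M, E)`, so that the bidual of `M` is `Hom_R(X, E)`.

Suppose the bidual is strongly torsion, and let `r ≠ 0` lie in all its associated primes. The radical
of the annihilator of an element is an intersection of associated primes, so every homomorphism
`X → E` vanishes on some `rⁿX`. If no `rⁿX` were finitely generated, a single homomorphism `X → E`
nonzero on every `rⁿX` could be built by successive extension along finitely generated submodules,
using that `E` is an injective cogenerator (`Matlis.exists_dual_ne_zero_on_each`). Hence `cX` is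
noetherian for some `c = rⁿ`. The dual of `cM` embeds into `cX`, so it is noetherian, and because
passing to the submodule of functionals vanishing on `U` reverses strict inclusions of submodules
`U` of `cM`, the module `cM` is artinian. A minimal module among the `scM` with `s ≠ 0` is
divisible, hence `D(M) = scM` and `sc` kills `M / D(M)`. The dual of `D(M)` is again noetherian, and
this makes `D(M)` artinian and reflexive (`Matlis.IsInjectiveHull.isReflexive_of_isNoetherian_dual`):
a functional on a finitely generated dual `Hom_R(B, E)` is killed by a power `𝔪ⁿ` of the maximal
ideal, so it comes from a functional on the dual of `B[𝔪ⁿ]`, which has finite length, and finite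
length modules are reflexive by induction from the simple one.

Conversely, if `r ≠ 0` kills `M / D(M)`, then `r` maps the bidual of `M` into the image of the bidual
of `D(M)`, which is `D(M)` itself. So an associated prime of the bidual contains `r` or is the
annihilator of an element of the artinian module `D(M)`, and then it is the maximal ideal. Therefore
`rs` lies in all associated primes for any `s` in the maximal ideal, which is nonzero as `R` is not
a field.
-/

namespace Matlis

open IsLocalRing Submodule

/-! ### Duals into an injective module -/

section Injective

variable {R : Type u} [CommRing R] [Small.{w} R] {E : Type w} [AddCommGroup E] [Module R E]
  {M : Type v} [AddCommGroup M] [Module R M]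

theorem exists_dual_extension (hE : Module.Injective R E) (N : Submodule R M) (g : Dual R E N) :
    ∃ f : Dual R E M, f ∘ₗ N.subtype = g :=
  Module.Injective.extension_property R E N M N.subtype N.injective_subtype g

/-- If no member of a sequence `W` of submodules is contained in a finitely generated
submodule, then a single homomorphism into a cogenerating injective module is nonzero on every
`W n`. It is built by successive extensions along finitely generated submodules. -/
theorem exists_dual_ne_zero_on_each (hE : Module.Injective R E)
    (hcog : ∀ N : Submodule R M, ∀ x ∉ N, ∃ f : Dual R E M, N ≤ LinearMap.ker f ∧ f x ≠ 0)
    (W : ℕ → Submodule R M) (hW : ∀ n, ∀ Y : Submodule R M, Y.FG → ¬ W n ≤ Y) :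
    ∃ f : Dual R E M, ∀ n, ∃ x ∈ W n, f x ≠ 0 := by
  have step : ∀ (n : ℕ) (p : {p : M →ₗ.[R] E // p.domain.FG}),
      ∃ q : {q : M →ₗ.[R] E // q.domain.FG}, p.1 ≤ q.1 ∧
        ∃ x : q.1.domain, (x : M) ∈ W n ∧ q.1 x ≠ 0 := by
    rintro n ⟨p, hp⟩
    obtain ⟨f, hf⟩ := exists_dual_extension hE p.domain p.toFun
    have key : ∃ g : Dual R E M, g ∘ₗ p.domain.subtype = p.toFun ∧ ∃ x ∈ W n, g x ≠ 0 := by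
      by_cases h : ∃ x ∈ W n, f x ≠ 0
      · exact ⟨f, hf, h⟩
      -- otherwise `f` vanishes on `W n`; add a homomorphism that vanishes on the domain of `p`
      push Not at h
      obtain ⟨x, hxW, hx⟩ := Set.not_subset.1 (hW n _ hp)
      obtain ⟨g, hg, hgx⟩ := hcog _ x hx
      refine ⟨f + g, ?_, x, hxW, by simpa [h x hxW] using hgx⟩
      rw [← hf]
      ext y
      simpa using hg y.2
    obtain ⟨g, hg, x, hxW, hgx⟩ := key
    refine ⟨⟨g.toPMap (p.domain ⊔ span R {x}), hp.sup (fg_span_singleton x)⟩, ⟨le_sup_left, ?_⟩,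
      ⟨x, mem_sup_right (mem_span_singleton_self x)⟩, hxW, hgx⟩
    rintro y z hyz
    have := LinearMap.congr_fun hg y
    exact this.symm.trans (congrArg g hyz)
  choose next hle hne using step
  let p : ℕ → {p : M →ₗ.[R] E // p.domain.FG} :=
    fun n => Nat.rec ⟨⊥, fg_bot⟩ (fun k q => next k q) n
  have hmono : Monotone fun n => (p n).1 := monotone_nat_of_le_succ fun n => hle n (p n)
  have hdir : DirectedOn (· ≤ ·) (Set.range fun n => (p n).1) :=
    hmono.directed_le.directedOn_range
  obtain ⟨f, hf⟩ := exists_dual_extension hE _ (LinearPMap.sSup _ hdir).toFun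
  refine ⟨f, fun n => ?_⟩
  obtain ⟨x, hxW, hx⟩ := hne n (p n)
  have hmem : (p (n + 1)).1 ∈ Set.range fun n => (p n).1 := ⟨n + 1, rfl⟩
  refine ⟨x, hxW, ?_⟩
  have h1 := LinearPMap.sSup_apply hdir hmem x
  have h2 := LinearMap.congr_fun hf ⟨x, (LinearPMap.le_sSup hdir hmem).1 x.2⟩
  intro h0
  exact hx (h1.symm.trans (h2.symm.trans h0))

/-- A functional on `Hom_R(M, E)` that kills all homomorphisms vanishing on `N` is a functional on
`Hom_R(N, E)`; so it is an evaluation when all functionals on `Hom_R(N, E)` are. -/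
theorem exists_eval_eq_of_vanishing (hE : Module.Injective R E) (N : Submodule R M)
    (hN : Function.Surjective (eval R E N)) (φ : Dual R E (Dual R E M))
    (hφ : ∀ f : Dual R E M, f ∘ₗ N.subtype = 0 → φ f = 0) :
    ∃ x ∈ N, eval R E M x = φ := by
  let ρ : Dual R E M →ₗ[R] Dual R E N := LinearMap.lcomp R E N.subtype
  have hρ : Function.Surjective ρ := exists_dual_extension hE N
  have hker : LinearMap.ker ρ ≤ LinearMap.ker φ := fun f hf => hφ f hf
  obtain ⟨x, hx⟩ := hN ((LinearMap.ker ρ).liftQ φ hker ∘ₗ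
    (ρ.quotKerEquivOfSurjective hρ).symm.toLinearMap)
  refine ⟨x, x.2, LinearMap.ext fun f => ?_⟩
  have h := LinearMap.congr_fun hx (ρ f)
  have h' : (ρ.quotKerEquivOfSurjective hρ).symm (ρ f) = Submodule.Quotient.mk f := by
    rw [LinearEquiv.symm_apply_eq]; rfl
  simp only [LinearMap.comp_apply, LinearEquiv.coe_coe, h', liftQ_apply] at h
  exact h

theorem eval_surjective_of_submodule_quotient (hE : Module.Injective R E) (N : Submodule R M)
    (hN : Function.Surjective (eval R E N)) (hQ : Function.Surjective (eval R E (M ⧸ N))) :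
    Function.Surjective (eval R E M) := by
  intro φ
  obtain ⟨q, hq⟩ := hQ (φ ∘ₗ LinearMap.lcomp R E N.mkQ)
  obtain ⟨x, rfl⟩ := N.mkQ_surjective q
  obtain ⟨y, -, hy⟩ := exists_eval_eq_of_vanishing hE N hN (φ - eval R E M x) fun f hf => by
    have hle : N ≤ LinearMap.ker f := fun z hz => LinearMap.congr_fun hf ⟨z, hz⟩
    have := LinearMap.congr_fun hq (N.liftQ f hle)
    simp only [eval_apply, LinearMap.comp_apply, LinearMap.lcomp_apply', liftQ_mkQ, mkQ_apply,
      liftQ_apply] at this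
    simp [this]
  exact ⟨y + x, by rw [map_add, hy, sub_add_cancel]⟩

/-- When `E` cogenerates the quotients of `M`, the map `U ↦ {f | f|_U = 0}` is strictly antitone, so the
ascending chain condition on the dual gives the descending one on `M`. -/
theorem isArtinian_of_isNoetherian_dual {R : Type u} [CommRing R] {E : Type w} [AddCommGroup E]
    [Module R E] {M : Type v} [AddCommGroup M] [Module R M]
    (hcog : ∀ N : Submodule R M, ∀ x ∉ N, ∃ f : Dual R E M, N ≤ LinearMap.ker f ∧ f x ≠ 0)
    [IsNoetherian R (Dual R E M)] : IsArtinian R M := by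
  let F : Submodule R M → Submodule R (Dual R E M) :=
    fun U => LinearMap.ker (LinearMap.lcomp R E U.subtype)
  have mem_F : ∀ U f, f ∈ F U ↔ U ≤ LinearMap.ker f := fun U f =>
    ⟨fun h z hz => LinearMap.congr_fun (LinearMap.mem_ker.1 h) ⟨z, hz⟩,
      fun h => LinearMap.mem_ker.2 (LinearMap.ext fun z => h z.2)⟩
  have hF : StrictAnti F := by
    intro U V hUV
    refine lt_of_le_not_ge (fun f hf => (mem_F _ _).2 (hUV.le.trans ((mem_F _ _).1 hf))) fun h => ?_
    obtain ⟨x, hxV, hxU⟩ := Set.exists_of_ssubset hUV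
    obtain ⟨f, hf, hfx⟩ := hcog U x hxU
    exact hfx ((mem_F _ _).1 (h ((mem_F _ _).2 hf)) hxV)
  exact hF.wellFoundedLT

/-- Precomposition with `c : M → cM` embeds `Hom_R(cM, E)` into `c • Hom_R(M, E)`: a homomorphism on
`cM` extends to some `f` on `M`, and goes to `c • f`. -/
theorem isNoetherian_dual_range_lsmul (hE : Module.Injective R E) (c : R)
    [IsNoetherian R (LinearMap.range (LinearMap.lsmul R (Dual R E M) c))] :
    IsNoetherian R (Dual R E (LinearMap.range (LinearMap.lsmul R M c))) := by
  let ρ := (LinearMap.lsmul R M c).rangeRestrict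
  let T : Dual R E (LinearMap.range (LinearMap.lsmul R M c)) →ₗ[R] Dual R E M :=
    LinearMap.lcomp R E ρ
  refine isNoetherian_of_injective
    (T.codRestrict (LinearMap.range (LinearMap.lsmul R (Dual R E M) c)) fun g => ?_)
    (LinearMap.ker_eq_bot.1 ?_)
  · obtain ⟨f, rfl⟩ := exists_dual_extension hE _ g
    exact ⟨f, LinearMap.ext fun x => (f.map_smul c x).symm⟩
  · rw [LinearMap.ker_codRestrict, LinearMap.ker_eq_bot]
    intro f g hfg
    exact (LinearMap.cancel_right (LinearMap.surjective_rangeRestrict _)).1 hfg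

end Injective

/-! ### The socle of the injective hull, and reflexivity of finite length modules -/

section Local

variable {R : Type u} [CommRing R] [IsLocalRing R]
  {E : Type w} [AddCommGroup E] [Module R E] {i : ResidueField R →ₗ[R] E}
  {M : Type v} [AddCommGroup M] [Module R M]

theorem smul_residueField_eq_zero {a : R} (ha : a ∈ maximalIdeal R) (k : ResidueField R) :
    a • k = 0 := by
  rw [Algebra.smul_def]
  rw [show algebraMap R (ResidueField R) a = residue R a from rfl, (residue_eq_zero_iff a).2 ha,
    zero_mul]

theorem IsInjectiveHull.exists_smul_mem_range (hE : IsInjectiveHull R i) {e : E} (he : e ≠ 0) :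
    ∃ r : R, r • e ≠ 0 ∧ r • e ∈ LinearMap.range i := by
  have h := hE.essential (span R {e}) (by simpa using he)
  obtain ⟨z, ⟨hz, hz'⟩, h0⟩ := (Submodule.ne_bot_iff _).1 h
  obtain ⟨r, rfl⟩ := mem_span_singleton.1 hz'
  exact ⟨r, h0, hz⟩

theorem IsInjectiveHull.mem_range_of_smul_eq_zero (hE : IsInjectiveHull R i) {e : E}
    (h : ∀ a ∈ maximalIdeal R, a • e = 0) : e ∈ LinearMap.range i := by
  by_cases he : e = 0
  · exact he ▸ zero_mem _
  obtain ⟨r, hr, hr'⟩ := hE.exists_smul_mem_range he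
  have hu : IsUnit r := by
    by_contra hu
    exact hr (h r ((mem_maximalIdeal r).2 hu))
  obtain ⟨u, rfl⟩ := hu
  have := (LinearMap.range i).smul_mem ((u⁻¹ : Rˣ) : R) hr'
  rwa [smul_smul, Units.inv_mul, one_smul] at this

theorem exists_smul_eq_of_mem_range {e e' : E} (he : e ∈ LinearMap.range i)
    (he' : e' ∈ LinearMap.range i) (h0 : e ≠ 0) : ∃ r : R, r • e = e' := by
  obtain ⟨k, rfl⟩ := he
  obtain ⟨k', rfl⟩ := he'
  have hk : k ≠ 0 := fun h => h0 (by rw [h, map_zero])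
  obtain ⟨r, hr⟩ := residue_surjective (k' * k⁻¹)
  refine ⟨r, ?_⟩
  rw [← map_smul, Algebra.smul_def, show algebraMap R (ResidueField R) r = residue R r from rfl, hr,
    inv_mul_cancel_right₀ hk]

theorem IsInjectiveHull.exists_dual_ne_zero [Small.{w} R] (hE : IsInjectiveHull R i) {x : M}
    (hx : x ≠ 0) : ∃ f : Dual R E M, f x ≠ 0 := by
  have hle : Ideal.torsionOf R M x ≤ maximalIdeal R :=
    le_maximalIdeal fun h => hx ((Ideal.torsionOf_eq_top_iff (R := R) x).1 h)
  let g : R ⧸ Ideal.torsionOf R M x →ₗ[R] E :=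
    i ∘ₗ (Ideal.torsionOf R M x).liftQ (Algebra.linearMap R (ResidueField R)) fun a ha =>
      (residue_eq_zero_iff a).2 (hle ha)
  obtain ⟨f, hf⟩ := exists_dual_extension hE.injective_module (span R {x})
    (g ∘ₗ (Ideal.quotTorsionOfEquivSpanSingleton R M x).symm.toLinearMap)
  refine ⟨f, fun h0 => ?_⟩
  have h := LinearMap.congr_fun hf ⟨x, mem_span_singleton_self x⟩
  have h1 : (Ideal.quotTorsionOfEquivSpanSingleton R M x).symm ⟨x, mem_span_singleton_self x⟩ =
      Submodule.Quotient.mk 1 := by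
    rw [LinearEquiv.symm_apply_eq]
    exact Subtype.ext (one_smul R x).symm
  simp only [LinearMap.comp_apply, LinearEquiv.coe_coe, h1, subtype_apply, h0, g] at h
  have h2 : (1 : ResidueField R) = 0 := (map_eq_zero_iff i hE.injective_map).1 h.symm
  exact one_ne_zero h2

theorem IsInjectiveHull.exists_dual_separating [Small.{w} R] (hE : IsInjectiveHull R i)
    (N : Submodule R M) (x : M) (hx : x ∉ N) :
    ∃ f : Dual R E M, N ≤ LinearMap.ker f ∧ f x ≠ 0 := by
  obtain ⟨f, hf⟩ := hE.exists_dual_ne_zero (x := N.mkQ x) (by simpa using hx)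
  exact ⟨f ∘ₗ N.mkQ, fun z hz => by simp [(Submodule.Quotient.mk_eq_zero N).2 hz], hf⟩

theorem IsInjectiveHull.eval_injective [Small.{w} R] (hE : IsInjectiveHull R i) :
    Function.Injective (eval R E M) := by
  rw [injective_iff_map_eq_zero]
  intro x hx
  by_contra h
  obtain ⟨f, hf⟩ := hE.exists_dual_ne_zero h
  exact hf (LinearMap.congr_fun hx f)

/-- The dual of a simple module is generated by any nonzero `f₀`, and a functional on it takes `f₀`
to a socle element of `E`, which is a value of `f₀`. -/
theorem IsInjectiveHull.eval_surjective_of_isSimpleModule [Small.{w} R]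
    (hE : IsInjectiveHull R i) [IsSimpleModule R M] : Function.Surjective (eval R E M) := by
  have : Nontrivial M := IsSimpleModule.nontrivial R M
  obtain ⟨x₀, hx₀⟩ := exists_ne (0 : M)
  have hgen : ∀ y : M, ∃ r : R, r • x₀ = y :=
    IsSimpleModule.toSpanSingleton_surjective R hx₀
  have hann : Module.annihilator R M = maximalIdeal R :=
    eq_maximalIdeal IsSimpleModule.annihilator_isMaximal
  have hkill : ∀ a ∈ maximalIdeal R, ∀ y : M, a • y = 0 := fun a ha =>
    Module.mem_annihilator.1 (hann ▸ ha)
  have hsoc : ∀ (f : Dual R E M) (y : M), f y ∈ LinearMap.range i := fun f y =>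
    hE.mem_range_of_smul_eq_zero fun a ha => by rw [← map_smul, hkill a ha, map_zero]
  obtain ⟨f₀, hf₀⟩ := hE.exists_dual_ne_zero hx₀
  -- `f₀` generates the dual, since the socle of `E` is a copy of the residue field
  have hdual : ∀ f : Dual R E M, ∃ r : R, r • f₀ = f := fun f => by
    obtain ⟨r, hr⟩ := exists_smul_eq_of_mem_range (hsoc f₀ x₀) (hsoc f x₀) hf₀
    refine ⟨r, LinearMap.ext fun y => ?_⟩
    obtain ⟨s, rfl⟩ := hgen y
    rw [map_smul, map_smul, LinearMap.smul_apply, hr]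
  intro φ
  have hφ : φ f₀ ∈ LinearMap.range i := hE.mem_range_of_smul_eq_zero fun a ha => by
    rw [← map_smul, show a • f₀ = 0 from LinearMap.ext fun y => by
      rw [LinearMap.smul_apply, ← map_smul, hkill a ha, map_zero, LinearMap.zero_apply], map_zero]
  obtain ⟨r, hr⟩ := exists_smul_eq_of_mem_range (hsoc f₀ x₀) hφ hf₀
  refine ⟨r • x₀, LinearMap.ext fun f => ?_⟩
  obtain ⟨s, rfl⟩ := hdual f
  rw [map_smul φ, ← hr]
  simp

theorem IsInjectiveHull.eval_surjective_of_isFiniteLength [Small.{w} R]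
    (hE : IsInjectiveHull R i) (hM : IsFiniteLength R M) : Function.Surjective (eval R E M) := by
  induction hM with
  | @of_subsingleton M _ _ _ =>
    intro φ
    refine ⟨0, LinearMap.ext fun f => ?_⟩
    rw [Subsingleton.elim f 0]
    simp
  | of_simple_quotient _ ih =>
    exact eval_surjective_of_submodule_quotient hE.injective_module _ ih
      hE.eval_surjective_of_isSimpleModule

/-- The quotient by `𝔪M` is a vector space over the residue field, and `𝔪M` is killed by a smaller
power of `𝔪`. -/
theorem isNoetherian_of_isArtinian_of_pow_smul_eq_zero {R : Type u} [CommRing R]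
    [IsLocalRing R] {M : Type v} [AddCommGroup M] [Module R M] [IsArtinian R M] (n : ℕ)
    (h : ∀ a ∈ maximalIdeal R ^ n, ∀ x : M, a • x = 0) : IsNoetherian R M := by
  induction n generalizing M with
  | zero =>
    have : Subsingleton M := subsingleton_of_forall_eq 0 fun x => by
      simpa using h 1 (by simp) x
    infer_instance
  | succ n ih =>
    let N : Submodule R M := maximalIdeal R • ⊤
    have hN : IsNoetherian R N := by
      refine ih fun a ha x => Subtype.ext ?_
      have hle : N ≤ LinearMap.ker (LinearMap.lsmul R M a) := smul_le.2 fun b hb y _ => by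
        rw [LinearMap.mem_ker, LinearMap.lsmul_apply, smul_smul]
        exact h _ (pow_succ (maximalIdeal R) n ▸ Ideal.mul_mem_mul ha hb) y
      exact hle x.2
    have hQ : Module.IsTorsionBySet R (M ⧸ N) (maximalIdeal R) :=
      Module.isTorsionBySet_quotient_ideal_smul M _
    let := hQ.module
    let : Field (R ⧸ maximalIdeal R) := Ideal.Quotient.field _
    have hss : IsSemisimpleModule R (M ⧸ N) := hQ.isSemisimpleModule_iff.1 inferInstance
    have htfae : IsNoetherian R (M ⧸ N) ↔ IsArtinian R (M ⧸ N) :=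
      IsSemisimpleModule.finite_tfae.out 1 2
    have : IsNoetherian R (M ⧸ N) := htfae.2 inferInstance
    exact (isNoetherian_iff_submodule_quotient N).2 ⟨hN, this⟩

end Local

/-! ### Modules with noetherian dual over a noetherian local ring -/

section Noetherian

variable {R : Type u} [CommRing R] [IsNoetherianRing R] {M : Type v} [AddCommGroup M] [Module R M]

/-- The radical of the annihilator of `x` is the intersection of the minimal primes above it, which
are associated primes. -/
theorem sInf_associatedPrimes_le_radical_colon (x : M) :
    sInf (associatedPrimes R M) ≤ ((⊥ : Submodule R M).colon {x}).radical := by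
  rw [← Ideal.sInf_minimalPrimes]
  refine le_sInf fun p hp => sInf_le ?_
  exact (isAssociatedPrime_iff).2 ⟨hp.1.1, exists_eq_colon_of_mem_minimalPrimes hp⟩

variable [IsLocalRing R] {E : Type w} [AddCommGroup E] [Module R E] {i : ResidueField R →ₗ[R] E}

/-- The maximal ideal is the only associated prime of `E`, by essentiality of the socle. -/
theorem IsInjectiveHull.maximalIdeal_le_sInf_associatedPrimes (hE : IsInjectiveHull R i) :
    maximalIdeal R ≤ sInf (associatedPrimes R E) := by
  refine le_sInf fun p hp a ha => ?_
  obtain ⟨hprime, x, rfl⟩ := isAssociatedPrime_iff.1 hp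
  have hx : x ≠ 0 := by
    rintro rfl
    exact hprime.ne_top (by simp)
  obtain ⟨r, hr, k, hk⟩ := hE.exists_smul_mem_range hx
  refine (hprime.mem_or_mem (x := a) (y := r) ?_).resolve_right fun h => hr (by simpa using h)
  rw [mem_colon_singleton, mem_bot, mul_smul, ← hk, ← map_smul, smul_residueField_eq_zero ha,
    map_zero]

theorem IsInjectiveHull.exists_pow_smul_eq_zero (hE : IsInjectiveHull R i) (e : E) :
    ∃ n, ∀ a ∈ maximalIdeal R ^ n, a • e = 0 := by
  obtain ⟨n, hn⟩ := Ideal.exists_pow_le_of_le_radical_of_fg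
    (hE.maximalIdeal_le_sInf_associatedPrimes.trans (sInf_associatedPrimes_le_radical_colon e))
    (IsNoetherian.noetherian _)
  exact ⟨n, fun a ha => by simpa using hn ha⟩

theorem IsInjectiveHull.exists_pow_smul_apply_eq_zero (hE : IsInjectiveHull R i)
    [Module.Finite R M] (f : Dual R E M) : ∃ n, ∀ a ∈ maximalIdeal R ^ n, ∀ x, a • f x = 0 := by
  obtain ⟨s, hs⟩ := Module.Finite.fg_top (R := R) (M := M)
  choose n hn using fun x => hE.exists_pow_smul_eq_zero (f x)
  refine ⟨s.sup n, fun a ha x => ?_⟩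
  have hle : span R (s : Set M) ≤ LinearMap.ker (LinearMap.lsmul R E a ∘ₗ f) :=
    span_le.2 fun y hy => hn y a (Ideal.pow_le_pow_right (Finset.le_sup hy) ha)
  exact hle (hs ▸ mem_top : x ∈ span R (s : Set M))

/-- `Hom_R(M / M[I], E) = I • Hom_R(M, E)`. -/
theorem mem_ideal_smul_dual_of_vanishing {R : Type u} [CommRing R] [IsNoetherianRing R]
    [Small.{w} R] {E : Type w} [AddCommGroup E] [Module R E] {M : Type v} [AddCommGroup M]
    [Module R M] (hE : Module.Injective R E) (I : Ideal R)
    (f : Dual R E M) (hf : ∀ x, (∀ a ∈ I, a • x = 0) → f x = 0) :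
    f ∈ I • (⊤ : Submodule R (Dual R E M)) := by
  obtain ⟨s, hs⟩ := (IsNoetherian.noetherian I : I.FG)
  -- `M / M[I]` embeds into a power of `M` through multiplication by generators of `I`
  let μ : M →ₗ[R] (s → M) := LinearMap.pi fun a => LinearMap.lsmul R M a
  have hker : LinearMap.ker μ ≤ LinearMap.ker f := fun x hx => by
    refine hf x fun a ha => ?_
    have hle : span R (s : Set R) ≤ LinearMap.ker (LinearMap.toSpanSingleton R M x) :=
      span_le.2 fun b hb => congrFun (LinearMap.mem_ker.1 hx) ⟨b, hb⟩
    exact hle (hs ▸ ha : a ∈ span R (s : Set R))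
  obtain ⟨g, hg⟩ := exists_dual_extension hE (LinearMap.range μ)
    ((LinearMap.ker μ).liftQ f hker ∘ₗ μ.quotKerEquivRange.symm.toLinearMap)
  have hgf : g ∘ₗ μ = f := by
    ext x
    have h := LinearMap.congr_fun hg ⟨μ x, x, rfl⟩
    have h' : μ.quotKerEquivRange.symm ⟨μ x, x, rfl⟩ = Submodule.Quotient.mk x := by
      rw [LinearEquiv.symm_apply_eq]; rfl
    simp only [LinearMap.comp_apply, LinearEquiv.coe_coe, h', liftQ_apply] at h
    exact h
  classical
  -- `f` is `g` applied to the tuple of the `a • x`, summed over the coordinates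
  have hsum : f = ∑ a : s, (a : R) • (g ∘ₗ LinearMap.single R (fun _ : s => M) a) := by
    rw [← hgf]
    ext x
    rw [LinearMap.comp_apply, ← LinearMap.sum_single_apply (fun _ : s => M) (μ x), map_sum,
      LinearMap.sum_apply]
    refine Finset.sum_congr rfl fun a _ => ?_
    rw [LinearMap.smul_apply, ← map_smul, LinearMap.comp_apply, map_smul]
    simp [μ, ← Pi.single_smul]
  rw [hsum]
  exact sum_mem fun a _ => smul_mem_smul (hs ▸ subset_span a.2) mem_top

/-- A functional on the finitely generated dual is killed by some `𝔪ⁿ`, so it lives on the dual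
of the finite length module `M[𝔪ⁿ]`, which is reflexive. -/
theorem IsInjectiveHull.isReflexive_of_isNoetherian_dual [Small.{w} R] (hE : IsInjectiveHull R i)
    [IsNoetherian R (Dual R E M)] : IsReflexive R E M := by
  refine ⟨hE.eval_injective, fun φ => ?_⟩
  have : IsArtinian R M := isArtinian_of_isNoetherian_dual hE.exists_dual_separating
  obtain ⟨n, hn⟩ := hE.exists_pow_smul_apply_eq_zero φ
  let N : Submodule R M := torsionBySet R M ((maximalIdeal R ^ n : Ideal R) : Set R)
  have hNnoeth : IsNoetherian R N :=
    isNoetherian_of_isArtinian_of_pow_smul_eq_zero n fun a ha x =>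
      Subtype.ext ((mem_torsionBySet_iff _ _).1 x.2 ⟨a, ha⟩)
  have hN : IsFiniteLength R N :=
    isFiniteLength_iff_isNoetherian_isArtinian.2 ⟨hNnoeth, inferInstance⟩
  obtain ⟨x, -, hx⟩ := exists_eval_eq_of_vanishing hE.injective_module N
    (hE.eval_surjective_of_isFiniteLength hN) φ fun f hf => by
      have hmem := mem_ideal_smul_dual_of_vanishing hE.injective_module (maximalIdeal R ^ n) f
        fun x hx => LinearMap.congr_fun hf ⟨x, (mem_torsionBySet_iff _ _).2 fun a => hx a a.2⟩
      have hle : maximalIdeal R ^ n • (⊤ : Submodule R (Dual R E M)) ≤ LinearMap.ker φ :=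
        smul_le.2 fun a ha g _ => by rw [LinearMap.mem_ker, map_smul, hn a ha g]
      exact hle hmem
  exact ⟨x, hx⟩

/-- In an artinian module over a local ring every element whose annihilator is a prime is killed by
the maximal ideal. -/
theorem mem_of_mem_maximalIdeal_of_isArtinian {R : Type u} [CommRing R] [IsLocalRing R]
    {M : Type v} [AddCommGroup M] [Module R M] [IsArtinian R M] {x : M} {p : Ideal R}
    [hp : p.IsPrime] (hx : ∀ a, a ∈ p ↔ a • x = 0) {a : R} (ha : a ∈ maximalIdeal R) : a ∈ p := by
  obtain ⟨n, ⟨y, hy⟩, h⟩ :=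
    IsArtinian.exists_pow_succ_smul_dvd a (⟨x, mem_span_singleton_self x⟩ : span R {x})
  obtain ⟨t, rfl⟩ := mem_span_singleton.1 hy
  have ht : a ^ (n + 1) • t • x = a ^ n • x := congrArg Subtype.val h
  have hmem : a ^ n * (1 - t * a) ∈ p := by
    rw [hx, mul_sub, mul_one, sub_smul, ← ht, smul_smul, sub_eq_zero]
    congr 1
    ring
  have hunit : IsUnit (1 - t * a) :=
    isUnit_one_sub_self_of_mem_nonunits _ ((maximalIdeal R).mul_mem_left t ha)
  exact hp.mem_of_pow_mem n ((hp.mem_or_mem hmem).resolve_right fun h =>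
    hp.ne_top (p.eq_top_of_isUnit_mem h hunit))

end Noetherian

/-! ### The divisible part -/

section Domain

variable {R : Type u} [CommRing R] [IsDomain R] {M : Type v} [AddCommGroup M] [Module R M]

/-- If `cM` is artinian for some `c ≠ 0`, a minimal module among the `scM` with `s ≠ 0` is
divisible. -/
theorem exists_divisiblePart_eq_range_lsmul {c : R} (hc : c ≠ 0)
    [IsArtinian R (LinearMap.range (LinearMap.lsmul R M c))] :
    ∃ s : R, s ≠ 0 ∧ divisiblePart R M = LinearMap.range (LinearMap.lsmul R M (s * c)) := by
  obtain ⟨_, ⟨s, hs, rfl⟩, hmin⟩ := IsArtinian.set_has_minimal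
    {N | ∃ s : R, s ≠ 0 ∧
      N = LinearMap.range (LinearMap.lsmul R (LinearMap.range (LinearMap.lsmul R M c)) s)}
    ⟨_, 1, one_ne_zero, rfl⟩
  refine ⟨s, hs, le_antisymm ?_ ?_⟩
  · intro x hx
    obtain ⟨y, hy⟩ := (isGreatest_divisiblePart R M).1 (s * c) (mul_ne_zero hs hc) ⟨x, hx⟩
    exact ⟨y, congrArg Subtype.val hy⟩
  · refine (isGreatest_divisiblePart R M).2 ?_
    rintro t ht ⟨_, x, rfl⟩
    have hle : LinearMap.range (LinearMap.lsmul R (LinearMap.range (LinearMap.lsmul R M c)) (t * s))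
        ≤ LinearMap.range (LinearMap.lsmul R (LinearMap.range (LinearMap.lsmul R M c)) s) := by
      rintro _ ⟨z, rfl⟩
      exact ⟨t • z, by simp [mul_smul]⟩
    have heq := hle.eq_of_not_lt (hmin _ ⟨t * s, mul_ne_zero ht hs, rfl⟩)
    obtain ⟨⟨_, z, rfl⟩, hz⟩ := heq.ge
      (LinearMap.mem_range_self (LinearMap.lsmul R _ s) ⟨c • x, x, rfl⟩)
    refine ⟨⟨(s * c) • z, z, rfl⟩, Subtype.ext ?_⟩
    have := congrArg Subtype.val hz
    simpa [mul_smul] using this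

end Domain

/-! ### Strongly torsion biduals -/

section Main

variable {R : Type u} [CommRing R] [IsDomain R] [IsLocalRing R] [IsNoetherianRing R]
  {E : Type w} [Small.{w} R] [AddCommGroup E] [Module R E] {i : ResidueField R →ₗ[R] E}
  {M : Type v} [AddCommGroup M] [Module R M]

/-- A common nonzero element `r` of the associated primes of the bidual makes the bidual
`r`-power torsion, so no functional is nonzero on all `rⁿ • Hom_R(M, E)`. -/
theorem IsInjectiveHull.exists_isNoetherian_range_lsmul_dual (hE : IsInjectiveHull R i)
    (hM : IsStronglyTorsion R (Dual R E (Dual R E M))) :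
    ∃ c : R, c ≠ 0 ∧ IsNoetherian R (LinearMap.range (LinearMap.lsmul R (Dual R E M) c)) := by
  obtain ⟨r, hr, hr0⟩ := (Submodule.ne_bot_iff _).1 hM
  by_contra! hcon
  -- a finitely generated module containing `rⁿ • Hom_R(M, E)` would make the latter noetherian
  obtain ⟨φ, hφ⟩ := exists_dual_ne_zero_on_each hE.injective_module hE.exists_dual_separating
    (fun n => LinearMap.range (LinearMap.lsmul R (Dual R E M) (r ^ n))) fun n Y hY hle => by
      have : IsNoetherian R Y := isNoetherian_of_fg_of_noetherian Y hY
      exact hcon _ (pow_ne_zero n hr0) (isNoetherian_of_le hle)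
  obtain ⟨n, hn⟩ := sInf_associatedPrimes_le_radical_colon φ hr
  obtain ⟨_, ⟨f, rfl⟩, hf⟩ := hφ n
  rw [mem_colon_singleton, mem_bot] at hn
  refine hf ?_
  rw [LinearMap.lsmul_apply, map_smul, ← LinearMap.smul_apply, hn, LinearMap.zero_apply]

theorem IsInjectiveHull.divisiblePart_of_isStronglyTorsion_bidual (hE : IsInjectiveHull R i)
    (hM : IsStronglyTorsion R (Dual R E (Dual R E M))) :
    (IsArtinian R (divisiblePart R M) ∧ IsReflexive R E (divisiblePart R M)) ∧
      IsBounded R (M ⧸ divisiblePart R M) := by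
  obtain ⟨c, hc, hnoeth⟩ := hE.exists_isNoetherian_range_lsmul_dual hM
  have := isNoetherian_dual_range_lsmul (M := M) hE.injective_module c
  have : IsArtinian R (LinearMap.range (LinearMap.lsmul R M c)) :=
    isArtinian_of_isNoetherian_dual hE.exists_dual_separating
  obtain ⟨s, hs, hD⟩ := exists_divisiblePart_eq_range_lsmul (M := M) hc
  rw [hD]
  have hle : LinearMap.range (LinearMap.lsmul R (Dual R E M) (s * c)) ≤
      LinearMap.range (LinearMap.lsmul R (Dual R E M) c) := by
    rintro _ ⟨f, rfl⟩
    exact ⟨s • f, by simp [mul_smul, smul_comm s c]⟩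
  have := isNoetherian_of_le hle
  have := isNoetherian_dual_range_lsmul (M := M) hE.injective_module (s * c)
  refine ⟨⟨isArtinian_of_isNoetherian_dual hE.exists_dual_separating,
    hE.isReflexive_of_isNoetherian_dual⟩, s * c, mul_ne_zero hs hc, fun x => ?_⟩
  obtain ⟨x, rfl⟩ := Submodule.mkQ_surjective _ x
  rw [← map_smul, mkQ_apply, Submodule.Quotient.mk_eq_zero]
  exact ⟨x, rfl⟩

/-- If `rM ⊆ D(M)` and `s` is a nonzero nonunit, then `rs` lies in every associated prime of the
bidual: `r` maps the bidual into the image of `D(M)`, whose associated primes are maximal. -/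
theorem IsInjectiveHull.isStronglyTorsion_bidual_of_divisiblePart (hE : IsInjectiveHull R i)
    (hR : ¬ IsField R) (hart : IsArtinian R (divisiblePart R M))
    (hrefl : IsReflexive R E (divisiblePart R M))
    (hbdd : IsBounded R (M ⧸ divisiblePart R M)) :
    IsStronglyTorsion R (Dual R E (Dual R E M)) := by
  obtain ⟨r, hr0, hr⟩ := hbdd
  obtain ⟨s, hs, hs0⟩ := (Submodule.ne_bot_iff _).1
    ((isField_iff_maximalIdeal_eq (R := R)).not.1 hR)
  refine (Submodule.ne_bot_iff _).2 ⟨r * s, ?_, mul_ne_zero hr0 hs0⟩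
  refine Submodule.mem_sInf.2 fun p hp => ?_
  obtain ⟨hprime, φ, hφ⟩ := isAssociatedPrime_iff.1 hp
  have hφ' : ∀ a, a ∈ p ↔ a • φ = 0 := fun a => by
    rw [hφ, mem_colon_singleton, mem_bot]
  by_cases hrp : r ∈ p
  · exact Ideal.mul_mem_right s p hrp
  refine Ideal.mul_mem_left p r ?_
  let ρ : M →ₗ[R] divisiblePart R M := (LinearMap.lsmul R M r).codRestrict _ fun x => by
    have h := hr (Submodule.Quotient.mk x)
    rwa [← Submodule.Quotient.mk_smul, Submodule.Quotient.mk_eq_zero] at h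
  obtain ⟨d, hd⟩ := hrefl.2 (φ ∘ₗ LinearMap.lcomp R E ρ)
  have hrφ : r • φ = eval R E M d := LinearMap.ext fun f => by
    have h := LinearMap.congr_fun hd (f ∘ₗ (divisiblePart R M).subtype)
    have h' : (f ∘ₗ (divisiblePart R M).subtype) ∘ₗ ρ = r • f :=
      LinearMap.ext fun x => f.map_smul r x
    rw [LinearMap.comp_apply, LinearMap.lcomp_apply', h', map_smul] at h
    exact h.symm
  refine mem_of_mem_maximalIdeal_of_isArtinian (x := d) (fun a => ?_) hs
  constructor
  · intro ha
    refine Subtype.ext (hE.eval_injective (M := M) ?_)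
    rw [Submodule.coe_smul, map_smul, ← hrφ, smul_comm, (hφ' a).1 ha, smul_zero, Submodule.coe_zero,
      map_zero]
  · intro ha
    have : a * r ∈ p := by
      rw [hφ', mul_smul, hrφ, ← map_smul, ← Submodule.coe_smul, ha, Submodule.coe_zero, map_zero]
    exact (hprime.mem_or_mem this).resolve_right hrp

end Main

end Matlis

theorem mainTheorem4 (R : Type u) [CommRing R] [IsDomain R] [IsLocalRing R]
    [IsNoetherianRing R] (hR : ¬ IsField R)
    (E : Type w) [Small.{w} R] [AddCommGroup E] [Module R E]
    (i : IsLocalRing.ResidueField R →ₗ[R] E) (hE : Matlis.IsInjectiveHull R i)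
    (M : Type v) [AddCommGroup M] [Module R M] :
    Matlis.IsStronglyTorsion R (Matlis.Dual R E (Matlis.Dual R E M)) ↔
      (IsArtinian R (Matlis.divisiblePart R M) ∧
        Matlis.IsReflexive R E (Matlis.divisiblePart R M)) ∧
      Matlis.IsBounded R (M ⧸ Matlis.divisiblePart R M) := by
  exact ⟨hE.divisiblePart_of_isStronglyTorsion_bidual, fun ⟨⟨hart, hrefl⟩, hbdd⟩ =>
    hE.isStronglyTorsion_bidual_of_divisiblePart hR hart hrefl hbdd⟩
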